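/- Let $K\subset\mathbb R^3$ be a tame oriented knot with tubular neighbourhood $n(K)$, let $\pi_K=\pi_1(\overline{\mathbb R^3\setminus n(K)},x)$ with base point $x$ on the boundary torus, let $m\in\pi_K$ be the meridian (the boundary of the meridian disk of $n(K)$ through $x$) and $\ell\in\pi_K$ the preferred (Seifert-framed) longitude. Fix $\Gamma=\{\gamma_1,\dots,\gamma_r\}\subset\pi_K$ with $\gamma_1=e$ the identity, such that the meridians $\gamma_i^{-1}m\gamma_i$ $(1\le i\le r)$ generate $\pi_K$. Let $\widetilde{\mathcal P}_K$ be the unital ring generated over $\mathbb Z$ by the symbols $[\gamma]$ $(\gamma\in\pi_K)$ and $\lambda^{\pm1},\mu^{\pm1}$, modulo the relations $\lambda\lambda^{-1}=\lambda^{-1}\lambda=\mu\mu^{-1}=\mu^{-1}\mu=1$, $\lambda\mu=\mu\lambda$, and (1) $[e]=1-\mu$; (2) $[m\gamma]=\mu[\gamma]$, $[\gamma m]=[\gamma]\mu$, $[\ell\gamma]=\lambda[\gamma]$, $[\gamma\ell]=[\gamma]\lambda$ for all $\gamma\in\pi_K$; (3) $[\gamma\gamma']-[\gamma m\gamma']=[\gamma][\gamma']$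 for all $\gamma,\gamma'\in\pi_K$. Let $\mathcal P_K$ be the algebra over $\mathbb Z[\lambda^{\pm1},\mu^{\pm1}]$ freely generated by the symbols $[\gamma]$, modulo (1)–(3). Let $\widetilde{\mathcal Q}_K$ be the universal localization of $\widetilde{\mathcal P}_K$ at $\{[e]^n\mid n\ge0\}$, and let $\iota:\widetilde{\mathcal P}_K\to\widetilde{\mathcal Q}_K$ be the localization homomorphism (the universal augmentation). An augmentation to a unital ring $S$ is a unital ring homomorphism from $\widetilde{\mathcal P}_K$ (or from $\mathcal P_K$) to $S$. For a unital ring $S$ and a right $S$-module $V$, a homomorphism $\rho:\pi_K\to\mathrm{Aut}_S(V)$ is a KCH representation if there are $\mu_0\in S$ with $1-\mu_0$ invertible and a finite generating family $e_1,\dots,e_n$ $(n\ge1)$ of $V$ with $\rho(m)e_1=e_1\mu_0$ and $\rho(m)e_i=e_i$ for $i\ge2$. It induces an augmentation $\epsilon$ to $S$ if, for some such family with $\mathrm{Ann}_S(e_1)=\{0\}$, one has $\mu_0=\epsilon(\mu)$, $\rho(\ell)e_1=e_1\epsilon(\lambda)$, and $\epsilon([\gamma])=(1-\mu_0)c_1$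 whenever $\gamma\in\pi_K$ and $\rho(\gamma)e_1=\sum_i e_ic_i$ with $c_i\in S$. (a) For $g\in\pi_K$ put $[\gamma_{\mathbf I}g]=([\gamma_1g],\dots,[\gamma_rg])\in\bigoplus^r\widetilde{\mathcal Q}_K$ (applying $\iota$ to the coordinates), and let $V$ be the right $\widetilde{\mathcal Q}_K$-submodule generated by $v_j=[\gamma_{\mathbf I}\gamma_j^{-1}]$, $1\le j\le r$. Then the rule $\rho_\iota(g)v_j=[\gamma_{\mathbf I}g\gamma_j^{-1}]$ gives a well-defined homomorphism $\rho_\iota:\pi_K\to\mathrm{Aut}_{\widetilde{\mathcal Q}_K}(V)$; it is a KCH representation and it induces $\iota$. (b) Let $S$ be a unital ring and let $\epsilon:\widetilde{\mathcal P}_K\to S$, or alternatively $\epsilon:\mathcal P_K\to S$, be an augmentation with $\epsilon(1-\mu)$ invertible in $S$. Then there are a right $S$-module $W$ and a KCH representation $\rho:\pi_K\to\mathrm{Aut}_S(W)$ that induces $\epsilon$. -/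

import Mathlib

open scoped RightActions

universe u

noncomputable section

/-! ## Knots, knot groups, meridians and longitudes -/

/-- Euclidean three-space. -/
abbrev E3 : Type := EuclideanSpace ℝ (Fin 3)

/-- A tubular neighbourhood of a closed curve `K` in three-space, parametrised by `S¹ × ℂ`.
The neighbourhood `n(K)` itself is the image of the part where the second coordinate has norm
less than `1`; the parametrisation extends past its boundary torus, which is therefore collared
on both sides. -/
structure TubularNbhd (K : Circle → E3) where
  toFun : Circle × ℂ → E3
  isEmbedding : Topology.IsEmbedding toFun
  core : ∀ z : Circle, toFun (z, 0) = K z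

/-- An (oriented, parametrised, tame) knot in three-space: an embedded circle that possesses a
tubular neighbourhood. -/
structure Knot where
  toFun : Circle → E3
  isEmbedding : Topology.IsEmbedding toFun
  tame : Nonempty (TubularNbhd toFun)

namespace TubularNbhd

variable {K : Circle → E3} (T : TubularNbhd K)

/-- The tubular neighbourhood `n(K)`. -/
def nbhd : Set E3 := T.toFun '' {p | ‖p.2‖ < 1}

/-- The complement of the knot: the closure of the complement of `n(K)`. -/
def exterior : Set E3 := closure (T.nbhd)ᶜ

theorem mem_exterior {p : Circle × ℂ} (hp : 1 ≤ ‖p.2‖) : T.toFun p ∈ T.exterior := by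
  apply subset_closure
  rintro ⟨q, hq, hqp⟩
  have h : q = p := T.isEmbedding.injective hqp
  subst h
  exact absurd hq (not_lt.mpr hp)

/-- The point of the boundary torus with coordinates `(z, w)`. -/
def torusPoint (z w : Circle) : T.exterior :=
  ⟨T.toFun (z, (w : ℂ)), T.mem_exterior (le_of_eq (Circle.norm_coe w).symm)⟩

theorem continuous_torusPoint : Continuous fun p : Circle × Circle => T.torusPoint p.1 p.2 := by
  apply Continuous.subtype_mk
  exact T.isEmbedding.continuous.comp (by fun_prop)

/-- The base point, which lies on the boundary torus of `n(K)`. -/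
def basePoint : T.exterior := T.torusPoint 1 1

/-- The loop `t ↦ exp (2πit)` on the circle. -/
def circleLoop (t : unitInterval) : Circle := Circle.exp (2 * Real.pi * (t : ℝ))

theorem continuous_circleLoop : Continuous circleLoop := by
  unfold circleLoop
  fun_prop

theorem circleLoop_zero : circleLoop 0 = 1 := by
  simp [circleLoop]

theorem circleLoop_one : circleLoop 1 = 1 := by
  simp [circleLoop]

/-- The boundary of the meridian disk of `n(K)` through the base point. -/
def meridianLoop : Path T.basePoint T.basePoint where
  toFun t := T.torusPoint 1 (circleLoop t)
  continuous_toFun :=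
    T.continuous_torusPoint.comp (continuous_const.prodMk continuous_circleLoop)
  source' := by rw [circleLoop_zero]; rfl
  target' := by rw [circleLoop_one]; rfl

/-- The parallel of the knot through the base point, in the framing given by `T`. -/
def parallelLoop : Path T.basePoint T.basePoint where
  toFun t := T.torusPoint (circleLoop t) 1
  continuous_toFun :=
    T.continuous_torusPoint.comp (continuous_circleLoop.prodMk continuous_const)
  source' := by rw [circleLoop_zero]; rfl
  target' := by rw [circleLoop_one]; rfl

/-- The knot group. Mathlib multiplies loops by `p * q = q.trans p`; passing to the opposite group
restores the usual convention that `p * q` is `p` followed by `q`. -/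
abbrev knotGroup : Type := (FundamentalGroup T.exterior T.basePoint)ᵐᵒᵖ

/-- The class of a loop in the knot group. -/
def loopClass (p : Path T.basePoint T.basePoint) : T.knotGroup :=
  MulOpposite.op (FundamentalGroup.fromPath (Path.Homotopic.Quotient.mk p))

/-- The meridian. -/
def meridian : T.knotGroup := T.loopClass T.meridianLoop

/-- `ℓ` is the preferred (Seifert-framed) longitude: it is represented on the boundary torus by a
parallel of the knot (the parallels being those of `T`, twisted any number of times about the
meridian) and it vanishes in the abelianisation `H₁` of the knot group, that is, its linking
number with the knot is zero. -/
def IsPreferredLongitude (l : T.knotGroup) : Prop :=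
  (∃ k : ℤ, l = T.meridian ^ k * T.loopClass T.parallelLoop) ∧ l ∈ commutator T.knotGroup

end TubularNbhd

/-! ## The fully noncommutative cord algebra

It is defined for any group `G` with two elements `m` and `l`, and used for a knot group with its
meridian and preferred longitude. -/

/-- The generators: the cords `[g]` and the letters `λ, λ⁻¹, μ, μ⁻¹`. -/
inductive CordGen (G : Type) : Type
  | cord (g : G)
  | lam
  | lamInv
  | mu
  | muInv

/-- The letters as elements of the free ring. -/
abbrev CordGen.free {G : Type} (x : CordGen G) : FreeAlgebra ℤ (CordGen G) := FreeAlgebra.ι ℤ x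

open CordGen in
/-- The defining relations. -/
inductive CordRel {G : Type} [Group G] (m l : G) :
    FreeAlgebra ℤ (CordGen G) → FreeAlgebra ℤ (CordGen G) → Prop
  | lam_lamInv : CordRel m l (lam.free * lamInv.free) 1
  | lamInv_lam : CordRel m l (lamInv.free * lam.free) 1
  | mu_muInv : CordRel m l (mu.free * muInv.free) 1
  | muInv_mu : CordRel m l (muInv.free * mu.free) 1
  | lam_mu : CordRel m l (lam.free * mu.free) (mu.free * lam.free)
  | one : CordRel m l (cord 1).free (1 - mu.free)
  | mer_mul (g : G) : CordRel m l (cord (m * g)).free (mu.free * (cord g).free)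
  | mul_mer (g : G) : CordRel m l (cord (g * m)).free ((cord g).free * mu.free)
  | lon_mul (g : G) : CordRel m l (cord (l * g)).free (lam.free * (cord g).free)
  | mul_lon (g : G) : CordRel m l (cord (g * l)).free ((cord g).free * lam.free)
  | skein (g h : G) :
      CordRel m l ((cord (g * h)).free - (cord (g * m * h)).free) ((cord g).free * (cord h).free)

/-- The fully noncommutative cord algebra `P̃`. -/
def NCCordAlg {G : Type} [Group G] (m l : G) : Type := RingQuot (CordRel m l)

instance {G : Type} [Group G] (m l : G) : Ring (NCCordAlg m l) :=
  inferInstanceAs (Ring (RingQuot (CordRel m l)))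

namespace NCCordAlg

variable {G : Type} [Group G] (m l : G)

/-- The quotient homomorphism from the free ring. -/
def mk : FreeAlgebra ℤ (CordGen G) →+* NCCordAlg m l := RingQuot.mkRingHom (CordRel m l)

/-- The class of a generator. -/
def gen (x : CordGen G) : NCCordAlg m l := mk m l x.free

/-- The element `[g]`. -/
def cord (g : G) : NCCordAlg m l := gen m l (CordGen.cord g)

/-- The element `μ`. -/
def mu : NCCordAlg m l := gen m l CordGen.mu

/-- The element `λ`. -/
def lam : NCCordAlg m l := gen m l CordGen.lam

end NCCordAlg

/-! ## The cord algebra over `R₀ = ℤ[λ^{±1}, μ^{±1}]` -/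

open scoped LaurentPolynomial in
/-- The ring `ℤ[λ^{±1}, μ^{±1}]`, as Laurent polynomials in `λ` over Laurent polynomials in `μ`. -/
def R0 : Type := ℤ[T;T⁻¹][T;T⁻¹]

open scoped LaurentPolynomial in
instance : CommRing R0 := inferInstanceAs (CommRing ℤ[T;T⁻¹][T;T⁻¹])

/-- The variable `λ`. -/
def R0.lam : R0 := LaurentPolynomial.T 1

/-- The variable `μ`. -/
def R0.mu : R0 := LaurentPolynomial.C (LaurentPolynomial.T 1)

/-- The defining relations over `R₀`; elements of `R₀` are central in the free algebra. -/
inductive CordRel0 {G : Type} [Group G] (m l : G) :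
    FreeAlgebra R0 G → FreeAlgebra R0 G → Prop
  | one : CordRel0 m l (FreeAlgebra.ι R0 1) (algebraMap R0 _ (1 - R0.mu))
  | mer_mul (g : G) : CordRel0 m l (FreeAlgebra.ι R0 (m * g)) (R0.mu • FreeAlgebra.ι R0 g)
  | mul_mer (g : G) : CordRel0 m l (FreeAlgebra.ι R0 (g * m)) (R0.mu • FreeAlgebra.ι R0 g)
  | lon_mul (g : G) : CordRel0 m l (FreeAlgebra.ι R0 (l * g)) (R0.lam • FreeAlgebra.ι R0 g)
  | mul_lon (g : G) : CordRel0 m l (FreeAlgebra.ι R0 (g * l)) (R0.lam • FreeAlgebra.ι R0 g)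
  | skein (g h : G) :
      CordRel0 m l (FreeAlgebra.ι R0 (g * h) - FreeAlgebra.ι R0 (g * m * h))
        (FreeAlgebra.ι R0 g * FreeAlgebra.ι R0 h)

/-- The cord algebra `P`, an algebra over `R₀`. -/
def CordAlg {G : Type} [Group G] (m l : G) : Type := RingQuot (CordRel0 m l)

instance {G : Type} [Group G] (m l : G) : Ring (CordAlg m l) :=
  inferInstanceAs (Ring (RingQuot (CordRel0 m l)))

namespace CordAlg

variable {G : Type} [Group G] (m l : G)

/-- The quotient homomorphism from the free `R₀`-algebra. -/
def mk : FreeAlgebra R0 G →+* CordAlg m l := RingQuot.mkRingHom (CordRel0 m l)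

/-- The element `[g]`. -/
def cord (g : G) : CordAlg m l := mk m l (FreeAlgebra.ι R0 g)

/-- The image of `r ∈ R₀`. -/
def coeff (r : R0) : CordAlg m l := mk m l (algebraMap R0 (FreeAlgebra R0 G) r)

/-- The element `μ`. -/
def mu : CordAlg m l := coeff m l R0.mu

/-- The element `λ`. -/
def lam : CordAlg m l := coeff m l R0.lam

end CordAlg

/-! ## Localization of a noncommutative ring at a set of elements -/

/-- The relations of the universal localization of `R` at `E`: the first family of generators is a
copy of the ring `R`, the second consists of two-sided inverses of the elements of `E`. -/
inductive UnivLocRel {R : Type} [Ring R] (E : Set R) :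
    FreeAlgebra ℤ (R ⊕ E) → FreeAlgebra ℤ (R ⊕ E) → Prop
  | one : UnivLocRel E (FreeAlgebra.ι ℤ (Sum.inl 1)) 1
  | add (a b : R) : UnivLocRel E (FreeAlgebra.ι ℤ (Sum.inl (a + b)))
      (FreeAlgebra.ι ℤ (Sum.inl a) + FreeAlgebra.ι ℤ (Sum.inl b))
  | mul (a b : R) : UnivLocRel E (FreeAlgebra.ι ℤ (Sum.inl (a * b)))
      (FreeAlgebra.ι ℤ (Sum.inl a) * FreeAlgebra.ι ℤ (Sum.inl b))
  | mul_inv (x : E) : UnivLocRel E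
      (FreeAlgebra.ι ℤ (Sum.inl (x : R)) * FreeAlgebra.ι ℤ (Sum.inr x)) 1
  | inv_mul (x : E) : UnivLocRel E
      (FreeAlgebra.ι ℤ (Sum.inr x) * FreeAlgebra.ι ℤ (Sum.inl (x : R))) 1

/-- The universal localization `E⁻¹R` of a not necessarily commutative ring. -/
def UnivLoc {R : Type} [Ring R] (E : Set R) : Type := RingQuot (UnivLocRel E)

instance {R : Type} [Ring R] (E : Set R) : Ring (UnivLoc E) :=
  inferInstanceAs (Ring (RingQuot (UnivLocRel E)))

namespace UnivLoc

variable {R : Type} [Ring R] (E : Set R)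

/-- The quotient homomorphism from the free ring. -/
def mk : FreeAlgebra ℤ (R ⊕ E) →+* UnivLoc E := RingQuot.mkRingHom (UnivLocRel E)

variable {E} in
theorem mk_rel {x y : FreeAlgebra ℤ (R ⊕ E)} (h : UnivLocRel E x y) : mk E x = mk E y :=
  RingQuot.mkRingHom_rel h

/-- The localization homomorphism. -/
def of : R →+* UnivLoc E :=
  RingHom.mk'
    { toFun := fun a => mk E (FreeAlgebra.ι ℤ (Sum.inl a))
      map_one' := by rw [mk_rel UnivLocRel.one, map_one]
      map_mul' := fun a b => by rw [mk_rel (UnivLocRel.mul a b), map_mul] }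
    (fun a b => by
      show mk E _ = mk E _ + mk E _
      rw [mk_rel (UnivLocRel.add a b), map_add])

theorem isUnit_of {x : R} (hx : x ∈ E) : IsUnit (of E x) := by
  refine ⟨⟨of E x, mk E (FreeAlgebra.ι ℤ (Sum.inr ⟨x, hx⟩)), ?_, ?_⟩, rfl⟩
  · have h := mk_rel (UnivLocRel.mul_inv (⟨x, hx⟩ : E))
    rwa [map_mul, map_one] at h
  · have h := mk_rel (UnivLocRel.inv_mul (⟨x, hx⟩ : E))
    rwa [map_mul, map_one] at h

/-- The universal property of the localization. -/
theorem existsUnique_lift {S : Type*} [Ring S] (f : R →+* S) (hf : ∀ x ∈ E, IsUnit (f x)) :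
    ∃! g : UnivLoc E →+* S, g.comp (of E) = f := by
  let F : R ⊕ E → S := Sum.elim f fun x => ((hf x.1 x.2).unit⁻¹ : Sˣ)
  let φ : FreeAlgebra ℤ (R ⊕ E) →+* S := (FreeAlgebra.lift ℤ F).toRingHom
  have hφ : ∀ y, φ (FreeAlgebra.ι ℤ y) = F y := fun y => FreeAlgebra.lift_ι_apply F y
  have hrel : ∀ ⦃x y⦄, UnivLocRel E x y → φ x = φ y := by
    intro x y h
    cases h with
    | one => simp [hφ, F]
    | add a b => simp [hφ, F]
    | mul a b => simp [hφ, F]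
    | mul_inv x => simp [hφ, F]
    | inv_mul x => simp [hφ, F]
  refine ⟨RingQuot.lift ⟨φ, hrel⟩, ?_, ?_⟩
  · ext a
    exact (RingQuot.lift_mkRingHom_apply φ hrel _).trans (hφ _)
  · intro g hg
    apply RingQuot.lift_unique
    have hinl : ∀ a, g (mk E (FreeAlgebra.ι ℤ (Sum.inl a))) = f a :=
      fun a => RingHom.congr_fun hg a
    have key : (g.comp (mk E)).toIntAlgHom = φ.toIntAlgHom := by
      apply FreeAlgebra.hom_ext
      funext y
      show g (mk E (FreeAlgebra.ι ℤ y)) = φ (FreeAlgebra.ι ℤ y)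
      rw [hφ]
      rcases y with a | x
      · exact hinl a
      · have h := congrArg g (mk_rel (UnivLocRel.inv_mul x))
        rw [map_mul, map_mul, map_one, map_one, hinl] at h
        have hu : (f x.1) * ((hf x.1 x.2).unit⁻¹ : Sˣ) = 1 := (hf x.1 x.2).mul_val_inv
        exact left_inv_eq_right_inv h hu
    exact RingHom.ext fun z => congrArg (fun ψ => ψ z) key

end UnivLoc

/-- The localization `Q̃` of the fully noncommutative cord algebra at the powers of `[e]`. -/
abbrev NCCordLoc {G : Type} [Group G] (m l : G) : Type :=
  UnivLoc (Submonoid.powers (NCCordAlg.cord m l 1) : Set (NCCordAlg m l))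

/-- The universal augmentation `ι : P̃ → Q̃`. -/
def univAug {G : Type} [Group G] (m l : G) : NCCordAlg m l →+* NCCordLoc m l :=
  UnivLoc.of _

/-! ## KCH representations on right modules

A right `S`-module is a module over `Sᵐᵒᵖ`, and `v <• s` is the right action of `s` on `v`. -/

section KCH

variable {G : Type} [Group G] {S : Type*} [Ring S] {V : Type*} [AddCommGroup V] [Module Sᵐᵒᵖ V]

/-- The finite family `e` generates the right module `V`, its first member is multiplied by
`μ₀` under `ρ(m)` and the others are fixed; moreover `1 - μ₀` is invertible. -/
structure IsKCHFrame (m : G) (ρ : G →* (V ≃ₗ[Sᵐᵒᵖ] V)) (μ₀ : S) {n : ℕ} (e : Fin (n + 1) → V) :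
    Prop where
  isUnit : IsUnit (1 - μ₀)
  span_eq_top : Submodule.span Sᵐᵒᵖ (Set.range e) = ⊤
  apply_zero : ρ m (e 0) = e 0 <• μ₀
  apply_ne_zero : ∀ i, i ≠ 0 → ρ m (e i) = e i

/-- `ρ` is a KCH representation. -/
def IsKCHRep (m : G) (ρ : G →* (V ≃ₗ[Sᵐᵒᵖ] V)) : Prop :=
  ∃ (μ₀ : S) (n : ℕ) (e : Fin (n + 1) → V), IsKCHFrame m ρ μ₀ e

/-- The KCH representation `ρ` induces the augmentation with `μ ↦ μ₀`, `λ ↦ l₀` and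
`[g] ↦ f g`: for some frame `e` with `Ann (e 0) = 0` one has `ρ(m) (e 0) = (e 0) μ₀`,
`ρ(ℓ) (e 0) = (e 0) l₀` and `f g = (1 - μ₀) ⟨ρ(g) (e 0), e 0⟩`, where `⟨v, e 0⟩` is the
coefficient of `e 0` in any expression of `v` through the frame. -/
def InducesValues (m l : G) (ρ : G →* (V ≃ₗ[Sᵐᵒᵖ] V)) (μ₀ l₀ : S) (f : G → S) : Prop :=
  ∃ (n : ℕ) (e : Fin (n + 1) → V), IsKCHFrame m ρ μ₀ e ∧
    (∀ s : S, e 0 <• s = 0 → s = 0) ∧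
    ρ l (e 0) = e 0 <• l₀ ∧
    ∀ (g : G) (c : Fin (n + 1) → S), ρ g (e 0) = ∑ i, e i <• c i → f g = (1 - μ₀) * c 0

/-- `ρ` induces the augmentation `ε` of the fully noncommutative cord algebra. -/
def Induces {m l : G} (ρ : G →* (V ≃ₗ[Sᵐᵒᵖ] V)) (ε : NCCordAlg m l →+* S) : Prop :=
  InducesValues m l ρ (ε (NCCordAlg.mu m l)) (ε (NCCordAlg.lam m l))
    fun g => ε (NCCordAlg.cord m l g)

/-- `ρ` induces the augmentation `ε` of the cord algebra over `R₀`. -/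
def Induces0 {m l : G} (ρ : G →* (V ≃ₗ[Sᵐᵒᵖ] V)) (ε : CordAlg m l →+* S) : Prop :=
  InducesValues m l ρ (ε (CordAlg.mu m l)) (ε (CordAlg.lam m l))
    fun g => ε (CordAlg.cord m l g)

end KCH

/-! ## The module of the universal representation -/

section UnivModule

variable {G : Type} [Group G] (m l : G) {r : ℕ} (γ : Fin (r + 1) → G)

/-- The vector `[γ_I g] = ([γ₁ g], …, [γ_r g])` over `Q̃`. -/
def cordVec (g : G) : Fin (r + 1) → NCCordLoc m l :=
  fun i => univAug m l (NCCordAlg.cord m l (γ i * g))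

/-- The right submodule `V` generated by the vectors `v_j = [γ_I γ_j⁻¹]`. -/
def univModule : Submodule (NCCordLoc m l)ᵐᵒᵖ (Fin (r + 1) → NCCordLoc m l) :=
  Submodule.span _ (Set.range fun j => cordVec m l γ (γ j)⁻¹)

/-- The generator `v_j` of `V`. -/
def univVec (j : Fin (r + 1)) : univModule m l γ :=
  ⟨cordVec m l γ (γ j)⁻¹, Submodule.subset_span ⟨j, rfl⟩⟩

end UnivModule

end

/-! Put `f g = ε [g]` and let `G` act on functions `G → S` by right translation. The skein relation
reads: the translate of `f` by `g * m * h` is its translate by `g * h` minus its translate by `g`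
times `f h`. Hence moving a translate by a conjugate meridian changes it only by a multiple of some
translate by `(γ i)⁻¹`; as these conjugates generate `G`, the finite span of the latter contains
every translate and is `G`-stable (`rightTranslate_mem_span`).

Well-definedness on tuples of values at the `γ i` is the real issue. A function in the span that
vanishes at all `γ i` is invariant under every conjugate meridian, hence constant, hence zero
(`eq_zero_of_apply_eq_zero`). So restriction to the `γ i` is an isomorphism, and the action is
carried across it.

For the frame, `f` itself is the eigenvector of `m` and `l`, and the other generators are corrected
by multiples of `f` so as to vanish at `1`. Evaluation at `1` then reads off the coefficient of `f`
(`spanRep_inducesValues`). Part (a) is the case `ε = ι`. -/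

noncomputable section

/-! ## Functions on a group that satisfy the cord relations -/

section CordFunction

variable {G : Type} [Group G] {S : Type*} [Ring S]

/-- `f : G → S` satisfies the relations of the cord algebra (those that concern multiplication on
the right), with `μ ↦ μ₀` and `λ ↦ l₀`, where `1 - μ₀` is invertible. -/
structure IsCordFunction (m l : G) (μ₀ l₀ : S) (f : G → S) : Prop where
  isUnit : IsUnit (1 - μ₀)
  map_one : f 1 = 1 - μ₀
  mul_mer : ∀ g, f (g * m) = f g * μ₀
  mul_lon : ∀ g, f (g * l) = f g * l₀
  skein : ∀ g h, f (g * h) - f (g * m * h) = f g * f h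

/-- Right translation of functions on `G`, a left action of `G`. -/
def rightTranslate (S : Type*) [Ring S] : G →* Module.End Sᵐᵒᵖ (G → S) where
  toFun g := LinearMap.funLeft Sᵐᵒᵖ S (· * g)
  map_one' := by ext f x; simp [LinearMap.funLeft_apply]
  map_mul' g h := by ext f x; simp [LinearMap.funLeft_apply, mul_assoc]

theorem rightTranslate_apply (g : G) (φ : G → S) (x : G) : rightTranslate S g φ x = φ (x * g) := rfl

variable {m l : G} {μ₀ l₀ : S} {f : G → S} {r : ℕ} {γ : Fin (r + 1) → G}

theorem rightTranslate_rightTranslate (g h : G) (φ : G → S) :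
    rightTranslate S g (rightTranslate S h φ) = rightTranslate S (g * h) φ := by
  rw [map_mul]; rfl

variable (f γ) in
/-- The right module generated by the translates of `f` by the `(γ j)⁻¹`. -/
def translateSpan : Submodule Sᵐᵒᵖ (G → S) :=
  Submodule.span _ (Set.range fun j => rightTranslate S (γ j)⁻¹ f)

variable (f γ) in
/-- The right module generated by the restrictions of these translates to the `γ i`. -/
def restrictedSpan : Submodule Sᵐᵒᵖ (Fin (r + 1) → S) :=
  Submodule.span _ (Set.range fun j i => f (γ i * (γ j)⁻¹))

theorem map_funLeft_translateSpan :
    (translateSpan f γ).map (LinearMap.funLeft Sᵐᵒᵖ S γ) = restrictedSpan f γ := by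
  rw [translateSpan, Submodule.map_span, ← Set.range_comp]
  rfl

namespace IsCordFunction

theorem rightTranslate_mer_mul (hf : IsCordFunction m l μ₀ l₀ f) (g h : G) :
    rightTranslate S (g * m * h) f = rightTranslate S (g * h) f - rightTranslate S g f <• f h := by
  funext x
  have := hf.skein (x * g) h
  simp only [mul_assoc] at this
  simp [rightTranslate_apply, mul_assoc, ← this]

/-- Modulo the span, left multiplication of the translating element by any `a` has no effect,
because this holds for the generating conjugate meridians; and `f` itself lies in the span. -/
theorem rightTranslate_mem_span (hf : IsCordFunction m l μ₀ l₀ f) (hγ₀ : γ 0 = 1)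
    (hγ : Subgroup.closure (Set.range fun i => (γ i)⁻¹ * m * γ i) = ⊤) (g : G) :
    rightTranslate S g f ∈ translateSpan f γ := by
  have hgen : ∀ j, rightTranslate S (γ j)⁻¹ f ∈ translateSpan f γ :=
    fun j => Submodule.subset_span ⟨j, rfl⟩
  have key : ∀ a h : G, rightTranslate S (a * h) f - rightTranslate S h f ∈ translateSpan f γ := by
    intro a
    have ha : a ∈ Subgroup.closure (Set.range fun i => (γ i)⁻¹ * m * γ i) := hγ ▸ trivial
    induction ha using Subgroup.closure_induction with
    | mem a ha =>
      obtain ⟨i, rfl⟩ := ha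
      intro h
      -- With these arguments the two translating elements become `h` and the conjugate meridian
      -- times `h`.
      have := hf.rightTranslate_mer_mul (γ i)⁻¹ (γ i * h)
      rw [inv_mul_cancel_left, ← mul_assoc] at this
      rw [this, sub_sub_cancel_left]
      exact neg_mem (Submodule.smul_mem _ _ (hgen i))
    | one => intro h; simp
    | mul a b _ _ iha ihb =>
      intro h
      have := add_mem (iha (b * h)) (ihb h)
      rwa [sub_add_sub_cancel, ← mul_assoc] at this
    | inv a _ ih =>
      intro h
      have := neg_mem (ih (a⁻¹ * h))
      rwa [neg_sub, mul_inv_cancel_left] at this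
  have := add_mem (key g 1)
    (show rightTranslate S 1 f ∈ translateSpan f γ by simpa only [hγ₀, inv_one] using hgen 0)
  rwa [sub_add_cancel, mul_one] at this

/-- The relation is right linear in `φ`, and for a translate of `f` by `k` it is the skein relation
for `g` and `h * k`. -/
theorem skein_of_mem_span (hf : IsCordFunction m l μ₀ l₀ f) {φ : G → S}
    (hφ : φ ∈ translateSpan f γ) (g h : G) :
    φ (g * h) - φ (g * m * h) = f g * φ h := by
  induction hφ using Submodule.span_induction with
  | mem φ hφ =>
    obtain ⟨j, rfl⟩ := hφ
    simpa only [rightTranslate_apply, mul_assoc] using hf.skein g (h * (γ j)⁻¹)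
  | zero => simp
  | add φ ψ _ _ hφ hψ =>
    simp only [Pi.add_apply, mul_add, ← hφ, ← hψ]
    abel
  | smul s φ _ hφ =>
    simp only [Pi.smul_apply, MulOpposite.smul_eq_mul_unop, ← sub_mul, hφ]
    rw [mul_assoc]

/-- Vanishing at `γ i` kills the right side of the skein relation, which makes `φ` invariant under
the `i`-th conjugate meridian. Thus `φ` is constant, with value `φ (γ 0) = 0`. -/
theorem eq_zero_of_apply_eq_zero (hf : IsCordFunction m l μ₀ l₀ f) (hγ₀ : γ 0 = 1)
    (hγ : Subgroup.closure (Set.range fun i => (γ i)⁻¹ * m * γ i) = ⊤) {φ : G → S}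
    (hφ : φ ∈ translateSpan f γ) (h0 : ∀ i, φ (γ i) = 0) : φ = 0 := by
  have key : ∀ a x : G, φ (x * a) = φ x := by
    intro a
    have ha : a ∈ Subgroup.closure (Set.range fun i => (γ i)⁻¹ * m * γ i) := hγ ▸ trivial
    induction ha using Subgroup.closure_induction with
    | mem a ha =>
      obtain ⟨i, rfl⟩ := ha
      intro x
      have := hf.skein_of_mem_span hφ (x * (γ i)⁻¹) (γ i)
      rw [h0, mul_zero, sub_eq_zero, inv_mul_cancel_right] at this
      simpa only [mul_assoc] using this.symm
    | one => simp
    | mul a b _ _ iha ihb => intro x; rw [← mul_assoc, ihb, iha]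
    | inv a _ ih => intro x; rw [← ih, inv_mul_cancel_right]
  funext x
  have := key x 1
  rw [one_mul, ← hγ₀, h0] at this
  exact this

theorem rightTranslate_mem (hf : IsCordFunction m l μ₀ l₀ f) (hγ₀ : γ 0 = 1)
    (hγ : Subgroup.closure (Set.range fun i => (γ i)⁻¹ * m * γ i) = ⊤) (g : G) :
    ∀ φ ∈ translateSpan f γ, rightTranslate S g φ ∈ translateSpan f γ := by
  intro φ hφ
  induction hφ using Submodule.span_induction with
  | mem φ hφ =>
    obtain ⟨j, rfl⟩ := hφ
    rw [rightTranslate_rightTranslate]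
    exact hf.rightTranslate_mem_span hγ₀ hγ _
  | zero => simp
  | add φ ψ _ _ hφ hψ => rw [map_add]; exact add_mem hφ hψ
  | smul s φ _ hφ => rw [map_smul]; exact Submodule.smul_mem _ _ hφ

/-- The action of `G` by translation on the module generated by the translates of `f`. -/
def spanRep (hf : IsCordFunction m l μ₀ l₀ f) (hγ₀ : γ 0 = 1)
    (hγ : Subgroup.closure (Set.range fun i => (γ i)⁻¹ * m * γ i) = ⊤) :
    G →* (translateSpan f γ ≃ₗ[Sᵐᵒᵖ] translateSpan f γ) :=
  -- Invertibility is automatic: a monoid homomorphism from a group takes values in units.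
  (LinearMap.GeneralLinearGroup.generalLinearEquiv Sᵐᵒᵖ
    (translateSpan f γ)).toMonoidHom.comp <| MonoidHom.toHomUnits
    { toFun := fun g => (rightTranslate S g).restrict (hf.rightTranslate_mem hγ₀ hγ g)
      map_one' := by ext φ x; simp
      map_mul' := fun g h => by ext φ x; simp [rightTranslate_apply, mul_assoc] }

theorem spanRep_apply (hf : IsCordFunction m l μ₀ l₀ f) (hγ₀ : γ 0 = 1)
    (hγ : Subgroup.closure (Set.range fun i => (γ i)⁻¹ * m * γ i) = ⊤) (g : G)
    (φ : translateSpan f γ) : (hf.spanRep hγ₀ hγ g φ : G → S) = rightTranslate S g φ := rfl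

/-- Restriction to the `γ i` is injective on the module generated by the translates of `f`. -/
def restrictEquiv (hf : IsCordFunction m l μ₀ l₀ f) (hγ₀ : γ 0 = 1)
    (hγ : Subgroup.closure (Set.range fun i => (γ i)⁻¹ * m * γ i) = ⊤) :
    translateSpan f γ ≃ₗ[Sᵐᵒᵖ] restrictedSpan f γ :=
  LinearEquiv.ofBijective
    ((LinearMap.funLeft Sᵐᵒᵖ S γ).restrict (q := restrictedSpan f γ) fun _ hφ =>
      map_funLeft_translateSpan (f := f) (γ := γ) ▸ Submodule.mem_map_of_mem hφ) <| by
    constructor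
    · rw [← LinearMap.ker_eq_bot, LinearMap.ker_eq_bot']
      intro φ h
      apply Subtype.ext
      refine hf.eq_zero_of_apply_eq_zero hγ₀ hγ φ.2 fun i => ?_
      exact congrFun (congrArg Subtype.val h) i
    · rintro ⟨ψ, hψ⟩
      rw [← map_funLeft_translateSpan] at hψ
      obtain ⟨φ, hφ, rfl⟩ := hψ
      exact ⟨⟨φ, hφ⟩, rfl⟩

theorem restrictEquiv_apply (hf : IsCordFunction m l μ₀ l₀ f) (hγ₀ : γ 0 = 1)
    (hγ : Subgroup.closure (Set.range fun i => (γ i)⁻¹ * m * γ i) = ⊤)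
    (φ : translateSpan f γ) (i : Fin (r + 1)) :
    (hf.restrictEquiv hγ₀ hγ φ : Fin (r + 1) → S) i = (φ : G → S) (γ i) := rfl

theorem spanRep_inducesValues (hf : IsCordFunction m l μ₀ l₀ f) (hγ₀ : γ 0 = 1)
    (hγ : Subgroup.closure (Set.range fun i => (γ i)⁻¹ * m * γ i) = ⊤) :
    InducesValues m l (hf.spanRep hγ₀ hγ) μ₀ l₀ f := by
  obtain ⟨u, hu⟩ := hf.isUnit
  have hu1 : (1 - μ₀) * (↑u⁻¹ : S) = 1 := by rw [← hu, Units.mul_inv]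
  have hμu : μ₀ * (↑u⁻¹ : S) = ↑u⁻¹ - 1 := by rw [← hu1]; noncomm_ring
  let v : Fin (r + 1) → translateSpan f γ :=
    fun j => ⟨rightTranslate S (γ j)⁻¹ f, Submodule.subset_span ⟨j, rfl⟩⟩
  let w : translateSpan f γ := ⟨f, by simpa using hf.rightTranslate_mem_span hγ₀ hγ 1⟩
  -- Since `f 1 = 1 - μ₀`, the correction is exactly the multiple of `f` that makes `e j` vanish at
  -- `1`.
  let e : Fin (r + 1) → translateSpan f γ :=
    fun j => if j = 0 then w else v j - w <• (↑u⁻¹ * f (γ j)⁻¹)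
  have he0 : e 0 = w := if_pos rfl
  have he : ∀ j, j ≠ 0 → e j = v j - w <• (↑u⁻¹ * f (γ j)⁻¹) := fun j hj => if_neg hj
  have he_one : ∀ j, j ≠ 0 → (e j : G → S) 1 = 0 := by
    intro j hj
    rw [he j hj]
    show f (1 * (γ j)⁻¹) - f 1 * (↑u⁻¹ * f (γ j)⁻¹) = 0
    rw [one_mul, hf.map_one, ← mul_assoc, hu1, one_mul, sub_self]
  refine ⟨r, e, ⟨hf.isUnit, ?_, ?_, ?_⟩, ?_, ?_, ?_⟩
  · have hv : Submodule.span Sᵐᵒᵖ (Set.range v) = ⊤ := by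
      apply Submodule.map_injective_of_injective (translateSpan f γ).injective_subtype
      rw [Submodule.map_span, ← Set.range_comp, Submodule.map_top, Submodule.range_subtype]
      rfl
    rw [eq_top_iff, ← hv, Submodule.span_le]
    rintro _ ⟨j, rfl⟩
    have hmem : ∀ i, e i ∈ Submodule.span Sᵐᵒᵖ (Set.range e) :=
      fun i => Submodule.subset_span ⟨i, rfl⟩
    by_cases hj : j = 0
    · have : v j = e 0 := by
        rw [he0]; apply Subtype.ext; funext x
        simp [v, w, hj, hγ₀]
      rw [this]; exact hmem 0
    · have : v j = e j + e 0 <• (↑u⁻¹ * f (γ j)⁻¹) := by rw [he j hj, he0, sub_add_cancel]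
      rw [this]; exact add_mem (hmem j) (Submodule.smul_mem _ _ (hmem 0))
  · rw [he0]
    apply Subtype.ext
    funext x
    exact hf.mul_mer x
  · intro j hj
    rw [he j hj]
    apply Subtype.ext
    funext x
    show f (x * m * (γ j)⁻¹) - f (x * m) * (↑u⁻¹ * f (γ j)⁻¹) =
      f (x * (γ j)⁻¹) - f x * (↑u⁻¹ * f (γ j)⁻¹)
    -- Under `m` both terms of `e j` change by `-(f x * f (γ j)⁻¹)`: the first by the skein
    -- relation, the second by `hμu`. The changes cancel.
    have := hf.skein x (γ j)⁻¹
    rw [hf.mul_mer, mul_assoc (f x), ← mul_assoc μ₀, hμu, sub_mul, one_mul, mul_sub, ← this]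
    abel
  · intro s hs
    rw [he0] at hs
    have : f 1 * s = 0 := congrFun (congrArg Subtype.val hs) 1
    rw [hf.map_one] at this
    exact (hf.isUnit.mul_right_eq_zero).1 this
  · rw [he0]
    apply Subtype.ext
    funext x
    exact hf.mul_lon x
  · intro g c hc
    -- At `1` only `e 0` survives, so every expression through the frame has the same `(1 - μ₀) * c
    -- 0`.
    have h1 : f (1 * g) = ((∑ i, e i <• c i : translateSpan f γ) : G → S) 1 := by
      rw [← hc, he0]; rfl
    rw [one_mul] at h1
    rw [h1, ← hf.map_one, AddSubmonoidClass.coe_finsetSum, Finset.sum_apply,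
      Finset.sum_eq_single 0]
    · rw [he0]; rfl
    · intro j _ hj
      show (e j : G → S) 1 * c j = 0
      rw [he_one j hj, zero_mul]
    · simp

end IsCordFunction

end CordFunction

/-! ### Transport of KCH representations along module isomorphisms. -/

section Transport

variable {G : Type} [Group G] {S : Type*} [Ring S] {V W : Type*} [AddCommGroup V]
  [Module Sᵐᵒᵖ V] [AddCommGroup W] [Module Sᵐᵒᵖ W] {m l : G} {ρ : G →* (V ≃ₗ[Sᵐᵒᵖ] V)}
  {μ₀ l₀ : S} {f : G → S}

/-- Conjugation of a representation by an isomorphism of modules. -/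
def conjRep (ρ : G →* (V ≃ₗ[Sᵐᵒᵖ] V)) (E : V ≃ₗ[Sᵐᵒᵖ] W) : G →* (W ≃ₗ[Sᵐᵒᵖ] W) where
  toFun g := (E.symm.trans (ρ g)).trans E
  map_one' := by ext w; simp
  map_mul' g h := by ext w; simp

theorem conjRep_apply (E : V ≃ₗ[Sᵐᵒᵖ] W) (g : G) (v : V) :
    conjRep ρ E g (E v) = E (ρ g v) := by
  simp [conjRep]

theorem InducesValues.isKCHRep (h : InducesValues m l ρ μ₀ l₀ f) : IsKCHRep m ρ := by
  obtain ⟨n, e, he, -⟩ := h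
  exact ⟨μ₀, n, e, he⟩

theorem InducesValues.conj (h : InducesValues m l ρ μ₀ l₀ f) (E : V ≃ₗ[Sᵐᵒᵖ] W) :
    InducesValues m l (conjRep ρ E) μ₀ l₀ f := by
  obtain ⟨n, e, ⟨h1, h2, h3, h4⟩, h5, h6, h7⟩ := h
  refine ⟨n, fun i => E (e i), ⟨h1, ?_, ?_, fun i hi => ?_⟩, fun s hs => ?_, ?_, fun g c hc => ?_⟩
  · rw [show (Set.range fun i => E (e i)) = (E : V →ₗ[Sᵐᵒᵖ] W) '' Set.range e from
      Set.range_comp E e, ← Submodule.map_span, h2, Submodule.map_top, LinearEquiv.range]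
  · rw [conjRep_apply, h3, map_smul]
  · rw [conjRep_apply, h4 i hi]
  · rw [← map_smul, LinearEquiv.map_eq_zero_iff] at hs
    exact h5 s hs
  · rw [conjRep_apply, h6, map_smul]
  · apply h7 g c
    apply E.injective
    rw [← conjRep_apply, hc, map_sum]
    simp only [map_smul]

end Transport

/-- A function that satisfies the cord relations is induced by a KCH representation on the span of
its translates. -/
theorem IsCordFunction.exists_rep {G : Type} [Group G] {S : Type*} [Ring S] {m l : G} {μ₀ l₀ : S}
    {f : G → S} (hf : IsCordFunction m l μ₀ l₀ f) {r : ℕ} {γ : Fin (r + 1) → G} (hγ₀ : γ 0 = 1)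
    (hγ : Subgroup.closure (Set.range fun i => (γ i)⁻¹ * m * γ i) = ⊤) :
    ∃ ρ : G →* (restrictedSpan f γ ≃ₗ[Sᵐᵒᵖ] restrictedSpan f γ),
      (∀ g j, (ρ g ⟨fun i => f (γ i * (γ j)⁻¹), Submodule.subset_span ⟨j, rfl⟩⟩ :
        Fin (r + 1) → S) = fun i => f (γ i * (g * (γ j)⁻¹))) ∧
      InducesValues m l ρ μ₀ l₀ f := by
  refine ⟨conjRep (hf.spanRep hγ₀ hγ) (hf.restrictEquiv hγ₀ hγ), fun g j => ?_,
    (hf.spanRep_inducesValues hγ₀ hγ).conj _⟩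
  have h := conjRep_apply (ρ := hf.spanRep hγ₀ hγ) (hf.restrictEquiv hγ₀ hγ) g
    ⟨rightTranslate S (γ j)⁻¹ f, Submodule.subset_span ⟨j, rfl⟩⟩
  refine (congrArg Subtype.val h).trans (funext fun i => ?_)
  rw [restrictEquiv_apply, spanRep_apply]
  simp [rightTranslate_apply, mul_assoc]

/-! ### Augmentations as cord functions. -/

section Augmentations

variable {G : Type} [Group G] {m l : G} {S : Type*} [Ring S]

theorem NCCordAlg.mk_rel {x y : FreeAlgebra ℤ (CordGen G)} (h : CordRel m l x y) :
    mk m l x = mk m l y :=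
  RingQuot.mkRingHom_rel h

theorem NCCordAlg.cord_one : cord m l 1 = 1 - mu m l := by
  exact (mk_rel CordRel.one).trans (by rw [map_sub, map_one]; rfl)

theorem NCCordAlg.isCordFunction (ε : NCCordAlg m l →+* S) (hε : IsUnit (ε (1 - mu m l))) :
    IsCordFunction m l (ε (mu m l)) (ε (lam m l)) fun g => ε (cord m l g) where
  isUnit := by simpa using hε
  map_one := by rw [cord_one, map_sub, map_one]
  mul_mer g := by
    rw [← map_mul]
    exact congrArg ε ((mk_rel (CordRel.mul_mer g)).trans (map_mul _ _ _))
  mul_lon g := by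
    rw [← map_mul]
    exact congrArg ε ((mk_rel (CordRel.mul_lon g)).trans (map_mul _ _ _))
  skein g h := by
    rw [← map_mul, ← map_sub]
    refine congrArg ε (Eq.trans (map_sub _ _ _).symm ?_)
    exact (mk_rel (CordRel.skein g h)).trans (map_mul _ _ _)

theorem CordAlg.mk_rel {x y : FreeAlgebra R0 G} (h : CordRel0 m l x y) :
    mk m l x = mk m l y :=
  RingQuot.mkRingHom_rel h

/-- Centrality of `R0` lets scalars be moved to the right, the side on which cord functions need `μ`
and `λ`. -/
theorem CordAlg.mk_smul (a : R0) (x : FreeAlgebra R0 G) :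
    mk m l (a • x) = mk m l x * coeff m l a := by
  rw [Algebra.smul_def, Algebra.commutes, map_mul]
  rfl

theorem CordAlg.isCordFunction (ε : CordAlg m l →+* S) (hε : IsUnit (ε (1 - mu m l))) :
    IsCordFunction m l (ε (mu m l)) (ε (lam m l)) fun g => ε (cord m l g) where
  isUnit := by simpa using hε
  map_one := by
    have h := mk_rel (CordRel0.one (m := m) (l := l))
    rw [map_sub, map_sub, map_one, map_one] at h
    rw [← map_one ε, ← map_sub]
    exact congrArg ε h
  mul_mer g := by
    rw [← map_mul]
    exact congrArg ε ((mk_rel (CordRel0.mul_mer g)).trans (mk_smul _ _))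
  mul_lon g := by
    rw [← map_mul]
    exact congrArg ε ((mk_rel (CordRel0.mul_lon g)).trans (mk_smul _ _))
  skein g h := by
    rw [← map_mul, ← map_sub]
    refine congrArg ε (Eq.trans (map_sub _ _ _).symm ?_)
    exact (mk_rel (CordRel0.skein g h)).trans (map_mul _ _ _)

theorem isUnit_univAug : IsUnit (univAug m l (1 - NCCordAlg.mu m l)) := by
  rw [← NCCordAlg.cord_one]
  exact UnivLoc.isUnit_of _ (Submonoid.mem_powers _)

end Augmentations

end

theorem mainTheorem2 (K : Knot) (N : TubularNbhd K.toFun) (l : N.knotGroup)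
    (hl : N.IsPreferredLongitude l) {r : ℕ} (γ : Fin (r + 1) → N.knotGroup) (hγ₀ : γ 0 = 1)
    (hγ : Subgroup.closure (Set.range fun i => (γ i)⁻¹ * N.meridian * γ i) = ⊤) :
    (∃ ρ : N.knotGroup →*
        (univModule N.meridian l γ ≃ₗ[(NCCordLoc N.meridian l)ᵐᵒᵖ] univModule N.meridian l γ),
      (∀ g j, (ρ g (univVec N.meridian l γ j) : Fin (r + 1) → NCCordLoc N.meridian l) =
        cordVec N.meridian l γ (g * (γ j)⁻¹)) ∧
      IsKCHRep N.meridian ρ ∧ Induces ρ (univAug N.meridian l)) ∧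
    (∀ (S : Type u) [Ring S] (ε : NCCordAlg N.meridian l →+* S),
      IsUnit (ε (1 - NCCordAlg.mu N.meridian l)) →
      ∃ (W : Type u) (_ : AddCommGroup W) (_ : Module Sᵐᵒᵖ W)
        (ρ : N.knotGroup →* (W ≃ₗ[Sᵐᵒᵖ] W)), IsKCHRep N.meridian ρ ∧ Induces ρ ε) ∧
    (∀ (S : Type u) [Ring S] (ε : CordAlg N.meridian l →+* S),
      IsUnit (ε (1 - CordAlg.mu N.meridian l)) →
      ∃ (W : Type u) (_ : AddCommGroup W) (_ : Module Sᵐᵒᵖ W)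
        (ρ : N.knotGroup →* (W ≃ₗ[Sᵐᵒᵖ] W)), IsKCHRep N.meridian ρ ∧ Induces0 ρ ε) := by
  refine ⟨?_, fun S _ ε hε => ?_, fun S _ ε hε => ?_⟩
  · obtain ⟨ρ, h₁, h₂⟩ :=
      (NCCordAlg.isCordFunction (univAug N.meridian l) isUnit_univAug).exists_rep hγ₀ hγ
    -- For `f = ι [·]` the module `restrictedSpan f γ` is `univModule` by definition.
    exact ⟨ρ, h₁, h₂.isKCHRep, h₂⟩
  · obtain ⟨ρ, -, h⟩ := (NCCordAlg.isCordFunction ε hε).exists_rep hγ₀ hγ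
    exact ⟨_, _, _, ρ, h.isKCHRep, h⟩
  · obtain ⟨ρ, -, h⟩ := (CordAlg.isCordFunction ε hε).exists_rep hγ₀ hγ
    exact ⟨_, _, _, ρ, h.isKCHRep, h⟩
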